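/- Let $k$ be a field of characteristic zero and $p$ a prime. Let $\mathcal{G}$ be the category of finite groups and conjugacy classes of surjective homomorphisms (homomorphisms $\varphi,\psi\colon G\to H$ are conjugate if $\psi=h\varphi h^{-1}$ for some $h\in H$). For a full subcategory $\mathcal{U}\le\mathcal{G}$ let $\mathcal{A}\mathcal{U}=[\mathcal{U}^{\mathrm{op}},\mathrm{Vect}_k]$ be the category of contravariant functors from $\mathcal U$ to $k$-vector spaces; for $\alpha\in\mathcal{U}(B,A)$ and $X\in\mathcal{A}\mathcal{U}$ write $\alpha^*\colon X(A)\to X(B)$ for the induced map, and for $G\in\mathcal{U}$ put $e_G=k[\mathcal{U}(-,G)]$. An object $X\in\mathcal{A}\mathcal{U}$ is - *finitely generated* if there is an epimorphism $\bigoplus_{i=1}^m e_{G_i}\to X$ with $m\ge 0$ and $G_1,\dots,G_m\in\mathcal{U}$; - *eventually torsion-free* if there is $r_0\in\mathbb{N}$ such that for every morphism $\alpha\colon B\to A$ of $\mathcal{U}$ with $|A|\ge r_0$ the map $\alpha^*\colon X(A)\to X(B)$ is injective; - *stably surjective* if there is $r_0\in\mathbb{N}$ such that for all $A,B\in\mathcal{U}$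 with $|B|\ge|A|\ge r_0$ the canonical map $$X(A)\otimes_k k[\mathcal{U}(B,A)]\to X(B),\qquad x\otimes[\alpha]\mapsto\alpha^*(x),$$ is surjective. Consider the full subcategories of $\mathcal{G}$: $\mathcal{Z}[p^\infty]$, the finite abelian $p$-groups; $\mathcal{C}[p^\infty]$, the finite cyclic $p$-groups; and, for $n\ge 1$, $\mathcal{F}[p^n]$, the groups isomorphic to $(\mathbb{Z}/p^n)^r$ for some $r\ge 0$. **Theorem.** Let $X\in\mathcal{A}\mathcal{Z}[p^\infty]$ be finitely generated. Then the restriction of $X$ to $\mathcal{C}[p^\infty]$ is eventually torsion-free and stably surjective, and for every $n\ge 1$ the restriction of $X$ to $\mathcal{F}[p^n]$ is eventually torsion-free and stably surjective. -/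

import Mathlib

open CategoryTheory

universe u

namespace OutRep

/-- A finite group (bundled), an object of the category `𝒢`. -/
structure FinGroup : Type (u + 1) where
  carrier : Type u
  [group : Group carrier]
  [finite : Finite carrier]

namespace FinGroup

instance : CoeSort FinGroup.{u} (Type u) := ⟨carrier⟩

instance (G : FinGroup.{u}) : Group G := G.group

instance (G : FinGroup.{u}) : Finite G := G.finite

/-- Surjective group homomorphisms. -/
abbrev SurjHom (G H : FinGroup.{u}) : Type u := {f : G →* H // Function.Surjective f}

/-- `φ, ψ : G → H` are conjugate if `ψ = c_h ∘ φ` for some `h ∈ H`, where `c_h x = h x h⁻¹`. -/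
def conjSetoid (G H : FinGroup.{u}) : Setoid (SurjHom G H) where
  r φ ψ := ∃ h : H, ∀ x : G, ψ.1 x = h * φ.1 x * h⁻¹
  iseqv :=
    { refl := fun φ => ⟨1, fun x => by simp⟩
      symm := fun {φ ψ} ⟨h, hh⟩ => ⟨h⁻¹, fun x => by rw [hh x]; group⟩
      trans := fun {φ ψ χ} ⟨h, hh⟩ ⟨g, hg⟩ => ⟨g * h, fun x => by rw [hg x, hh x]; group⟩ }

/-- The category `𝒢`: finite groups and conjugacy classes of surjective homomorphisms. -/
instance : Category.{u} FinGroup.{u} where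
  Hom G H := Quotient (conjSetoid G H)
  id G := Quotient.mk _ ⟨MonoidHom.id G, Function.surjective_id⟩
  comp {G H K} f g := Quotient.map₂ (sa := conjSetoid G H) (sb := conjSetoid H K)
    (sc := conjSetoid G K)
    (fun φ ψ => ⟨ψ.1.comp φ.1, ψ.2.comp φ.2⟩)
    (by
      rintro φ φ' ⟨h, hh⟩ ψ ψ' ⟨g, hg⟩
      refine ⟨g * ψ.1 h, fun x => ?_⟩
      simp only [MonoidHom.comp_apply]
      rw [hg, hh, map_mul, map_mul, map_inv]
      group) f g
  id_comp f := by
    induction f using Quotient.inductionOn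
    rfl
  comp_id f := by
    induction f using Quotient.inductionOn
    rfl
  assoc f g h := by
    induction f using Quotient.inductionOn
    induction g using Quotient.inductionOn
    induction h using Quotient.inductionOn
    rfl

end FinGroup

/-- `𝒵[p^∞]`: finite abelian `p`-groups. -/
def abelianPGroups (p : ℕ) : ObjectProperty FinGroup.{u} :=
  fun G => (∀ a b : G, a * b = b * a) ∧ IsPGroup p G

/-- `𝒞[p^∞]`: finite cyclic `p`-groups. -/
def cyclicPGroups (p : ℕ) : ObjectProperty FinGroup.{u} :=
  fun G => IsCyclic G ∧ IsPGroup p G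

/-- `ℱ[p^n]`: groups isomorphic to `(ℤ/p^n)^r` for some `r ≥ 0`. -/
def freeModGroups (p n : ℕ) : ObjectProperty FinGroup.{u} :=
  fun G => ∃ r : ℕ, Nonempty (G ≃* Multiplicative (Fin r → ZMod (p ^ n)))

theorem cyclicPGroups_le (p : ℕ) : cyclicPGroups.{u} p ≤ abelianPGroups p := by
  rintro G ⟨hc, hp⟩
  haveI : IsMulCommutative G := IsCyclic.isMulCommutative
  exact ⟨fun a b => mul_comm' a b, hp⟩

theorem freeModGroups_le (p n : ℕ) : freeModGroups.{u} p n ≤ abelianPGroups p := by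
  rintro G ⟨r, ⟨e⟩⟩
  refine ⟨fun a b => e.injective ?_, ?_⟩
  · rw [map_mul, map_mul, mul_comm]
  · refine IsPGroup.of_card (n := n * r) ?_
    rw [Nat.card_congr e.toEquiv, Nat.card_congr Multiplicative.toAdd, Nat.card_fun,
      Nat.card_zmod, Nat.card_fin, pow_mul]

variable (k : Type u) [Field k]

/-- `𝒜𝒰 = [𝒰ᵒᵖ, Vect_k]` for a full subcategory `𝒰` of `𝒢`. -/
abbrev RepCat (U : ObjectProperty FinGroup.{u}) : Type (u + 1) :=
  U.FullSubcategoryᵒᵖ ⥤ ModuleCat.{u} k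

/-- The generator `e_G = k[𝒰(-, G)]`. -/
noncomputable def generator {U : ObjectProperty FinGroup.{u}} (G : U.FullSubcategory) : RepCat k U :=
  yoneda.obj G ⋙ ModuleCat.free k

variable {k}

/-- `X` is finitely generated: there is an epimorphism onto `X` from a finite direct sum
`e_{G₁} ⊕ ⋯ ⊕ e_{Gₘ}`. -/
def IsFinitelyGenerated {U : ObjectProperty FinGroup.{u}} (X : RepCat k U) : Prop :=
  ∃ (m : ℕ) (G : Fin m → U.FullSubcategory) (f : (∐ fun i => generator k (G i)) ⟶ X), Epi f

/-- Restriction along an inclusion `𝒱 ≤ 𝒰` of full subcategories. -/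
def restrict {V U : ObjectProperty FinGroup.{u}} (h : V ≤ U) (X : RepCat k U) : RepCat k V :=
  (ObjectProperty.ιOfLE h).op ⋙ X

/-- The structure map `α^* : X(A) → X(B)` of a morphism `α : B → A`. -/
def structureMap {U : ObjectProperty FinGroup.{u}} (X : RepCat k U) {A B : U.FullSubcategory}
    (α : B ⟶ A) : X.obj (Opposite.op A) →ₗ[k] X.obj (Opposite.op B) :=
  (X.map α.op).hom

/-- The canonical map `X(A) ⊗ k[𝒰(B, A)] → X(B)`, `x ⊗ [α] ↦ α^*(x)`. -/
noncomputable def actionMap {U : ObjectProperty FinGroup.{u}} (X : RepCat k U)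
    (A B : U.FullSubcategory) :
    TensorProduct k (X.obj (Opposite.op A)) ((B ⟶ A) →₀ k) →ₗ[k] X.obj (Opposite.op B) :=
  TensorProduct.lift (Finsupp.linearCombination k fun α : B ⟶ A => structureMap X α).flip

theorem actionMap_tmul_single {U : ObjectProperty FinGroup.{u}} (X : RepCat k U)
    (A B : U.FullSubcategory) (x : X.obj (Opposite.op A)) (α : B ⟶ A) :
    actionMap X A B (TensorProduct.tmul k x (Finsupp.single α 1)) = structureMap X α x := by
  simp [actionMap]

/-- `X` is eventually torsion-free: there is `r₀` such that `α^* : X(A) → X(B)` is injective for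
every `α : B → A` with `|A| ≥ r₀`. -/
def EventuallyTorsionFree {U : ObjectProperty FinGroup.{u}} (X : RepCat k U) : Prop :=
  ∃ r₀ : ℕ, ∀ (A B : U.FullSubcategory) (α : B ⟶ A), r₀ ≤ Nat.card A.obj →
    Function.Injective (structureMap X α)

/-- `X` is stably surjective: there is `r₀` such that `X(A) ⊗ k[𝒰(B, A)] → X(B)` is surjective
whenever `|B| ≥ |A| ≥ r₀`. -/
def StablySurjective {U : ObjectProperty FinGroup.{u}} (X : RepCat k U) : Prop :=
  ∃ r₀ : ℕ, ∀ A B : U.FullSubcategory, r₀ ≤ Nat.card A.obj → Nat.card A.obj ≤ Nat.card B.obj →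
    Function.Surjective (actionMap X A B)

end OutRep

/-! Finite generation means that elements `y i ∈ X(G i)` span every `X(H)` under pullback along `H →
G i` (`IsFinitelyGenerated.exists_generates`), so the question becomes how surjections `H → G i`
factor.

Cyclic groups: if `B` is cyclic and `|A| ≥ |G i|` for all `i`, every `B → G i` factors through every
`B → A`, so `α^*` is surjective (`Generates.surjective_of_isCyclic`). The dimensions are finite and
can only drop, hence stabilise, and then `α^*` is bijective.

Free `ℤ/p^n`-modules: a surjection `(ℤ/p^n)^b → G i` is determined by the word of its values on the
basis. If `|G i| ≤ a ≤ b`, repeated letters let it factor through rank `a`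
(`FreeMod.exists_factor`); this gives stable surjectivity. For torsion-freeness, any map to `A` from
a free module of large rank lifts through a given `α : B → A` (`FreeMod.exists_lift`), so `ker α^*`
consists of elements killed by all maps from large rank. These form a subobject `torsion`. A Gröbner
basis argument, resting on Higman's lemma for words over the finite alphabet `⨆ G i`, shows that it
is finitely generated (`exists_finset_generators`). Finitely many generators all die beyond a common
rank, so torsion vanishes there. -/

namespace OutRep

/-! ### Words and ordered surjections -/

/-- A surjection of finite ordinals whose first hits of `0, 1, …` occur in increasing order. -/
structure IsOrderedSurjection {c b : ℕ} (σ : Fin c → Fin b) : Prop where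
  surjective : Function.Surjective σ
  exists_lt : ∀ j, ∀ i < σ j, ∃ j' < j, σ j' = i

/-- If `v` and `w` first differ at `i`, the composites first differ at the first `j` with `σ j = i`:
before it `σ` takes only values below `i`, since a larger value would need an earlier hit of `i`. -/
theorem IsOrderedSurjection.toLex_comp_lt {S : Type*} [LinearOrder S] {c b : ℕ}
    {σ : Fin c → Fin b} (hσ : IsOrderedSurjection σ) {v w : Fin b → S}
    (h : toLex v < toLex w) : toLex (v ∘ σ) < toLex (w ∘ σ) := by
  obtain ⟨i, hi, hlt⟩ := h
  obtain ⟨j, hj, hmin⟩ := WellFounded.has_min (wellFounded_lt (α := Fin c)) {j | σ j = i}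
    (hσ.surjective i)
  simp only [Set.mem_ofPred_eq] at hj hmin
  refine ⟨j, fun j' hj' => ?_, ?_⟩
  · refine hi (σ j') ?_
    rcases lt_trichotomy (σ j') i with h | h | h
    · exact h
    · exact absurd hj' (hmin j' h)
    · obtain ⟨j'', h1, h2⟩ := hσ.exists_lt j' i h
      exact absurd (h1.trans hj') (hmin j'' h2)
  · change v (σ j) < w (σ j)
    rw [hj]
    exact hlt

/-- `w'` arises from `w` by precomposition with an ordered surjection. -/
def WordLE {S : Type*} (w w' : Σ b, Fin b → S) : Prop :=
  ∃ σ : Fin w'.1 → Fin w.1, IsOrderedSurjection σ ∧ w'.2 = w.2 ∘ σ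

/-- The letter at position `j` occurs there for the first time. -/
def IsFirst {S : Type*} {b : ℕ} (w : Fin b → S) (j : Fin b) : Prop :=
  ∀ j' < j, w j' ≠ w j

/-- The map `σ` inverts `φ` on its image and sends any other position to the first occurrence in `w`
of its letter. Since `φ` preserves first occurrences, `φ (σ j) ≤ j` always, and this makes `σ`
ordered. -/
theorem wordLE_of_orderEmbedding {S : Type*} {b c : ℕ} {w : Fin b → S} {w' : Fin c → S}
    (φ : Fin b ↪o Fin c) (hφ : ∀ i, w i = w' (φ i)) (hfirst : ∀ i, IsFirst w i → IsFirst w' (φ i))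
    (hrange : Set.range w' ⊆ Set.range w) : WordLE ⟨b, w⟩ ⟨c, w'⟩ := by
  classical
  have key : ∀ j : Fin c, ∃ i : Fin b, w i = w' j ∧ (∀ i', φ i' = j → i' = i) ∧ φ i ≤ j := by
    intro j
    by_cases h : ∃ i, φ i = j
    · obtain ⟨i, rfl⟩ := h
      exact ⟨i, hφ i, fun i' h => φ.injective h, le_rfl⟩
    · obtain ⟨i, hi, hmin⟩ := WellFounded.has_min (wellFounded_lt (α := Fin b)) {i | w i = w' j}
        (hrange ⟨j, rfl⟩)
      simp only [Set.mem_ofPred_eq] at hi hmin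
      refine ⟨i, hi, fun i' h' => absurd ⟨i', h'⟩ h, ?_⟩
      have hf : IsFirst w' (φ i) := hfirst i fun i' hlt heq => hmin i' (heq.trans hi) hlt
      by_contra hlt
      exact hf j (not_le.1 hlt) (by rw [← hφ, hi])
  choose σ h1 h2 h3 using key
  have hσφ : ∀ i, σ (φ i) = i := fun i => (h2 _ i rfl).symm
  exact ⟨σ, ⟨fun i => ⟨φ i, hσφ i⟩,
    fun j i hi => ⟨φ i, (φ.lt_iff_lt.2 hi).trans_le (h3 j), hσφ i⟩⟩,
    funext fun j => (h1 j).symm⟩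

/-- Words over a finite alphabet are well-quasi-ordered under `WordLE`. -/
theorem wellQuasiOrdered_wordLE (S : Type*) [Finite S] :
    WellQuasiOrdered (WordLE (S := S)) := by
  classical
  have hset : WellQuasiOrdered (fun s t : Set S => s = t) := Finite.wellQuasiOrdered _
  have hlist : WellQuasiOrdered (List.SublistForall₂ (· = · : S × Bool → S × Bool → Prop)) := by
    have := Set.PartiallyWellOrderedOn.partiallyWellOrderedOn_sublistForall₂
      (α := S × Bool) (· = ·) (s := Set.univ) ((Set.toFinite _).partiallyWellOrderedOn)
    rw [Set.partiallyWellOrderedOn_iff_exists_lt] at this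
    exact fun f => this f fun n x _ => Set.mem_univ x
  intro f
  -- Higman's lemma is applied to words whose letters carry a first-occurrence flag, so that the
  -- subword embedding preserves first occurrences; the set of letters used is matched separately.
  obtain ⟨m, n, hmn, hs, hl⟩ := (hset.prod hlist) fun n =>
    (Set.range (f n).2, List.ofFn fun j => ((f n).2 j, decide (IsFirst (f n).2 j)))
  refine ⟨m, n, hmn, ?_⟩
  obtain ⟨l, hl1, hl2⟩ := List.sublistForall₂_iff.1 hl
  obtain rfl := List.forall₂_eq_eq_eq ▸ hl1
  obtain ⟨φ, hφ⟩ := List.sublist_iff_exists_fin_orderEmbedding_get_eq.1 hl2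
  generalize f m = w at *
  generalize f n = w' at *
  obtain ⟨b, w⟩ := w
  obtain ⟨c, w'⟩ := w'
  let φ' : Fin b ↪o Fin c := ((Fin.castOrderIso (List.length_ofFn)).symm.toOrderEmbedding.trans
    φ).trans (Fin.castOrderIso (List.length_ofFn)).toOrderEmbedding
  have h : ∀ i, w i = w' (φ' i) ∧ decide (IsFirst w i) = decide (IsFirst w' (φ' i)) := by
    intro i
    have := hφ ((Fin.castOrderIso (List.length_ofFn)).symm i)
    simp only [List.get_ofFn, Prod.mk.injEq] at this
    exact this
  exact wordLE_of_orderEmbedding φ' (fun i => (h i).1)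
    (fun i hi => by simpa [hi] using (h i).2) hs.symm.subset

/-- In a well-quasi-order every set contains a finite subset below all its elements. -/
theorem exists_finset_below {α : Type*} {r : α → α → Prop} (hr : WellQuasiOrdered r)
    (L : Set α) : ∃ F : Finset α, (∀ x ∈ F, x ∈ L) ∧ ∀ y ∈ L, ∃ x ∈ F, r x y := by
  by_contra! h
  obtain ⟨f, -, hf⟩ := exists_seq_of_forall_finset_exists (· ∈ L) (fun x y => ¬ r x y)
    (fun s hs => h s hs)
  obtain ⟨m, n, hmn, h⟩ := hr f
  exact hf m n hmn h

/-! ### Leading terms -/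

section LeadingTerms

variable {k : Type*} [Field k] {S : Type*}

/-- The action of a map `σ` on linear combinations of words. -/
noncomputable def pullback (k : Type*) [Field k] {S : Type*} {c b : ℕ} (σ : Fin c → Fin b) :
    ((Fin b → S) →₀ k) →ₗ[k] ((Fin c → S) →₀ k) :=
  Finsupp.lmapDomain k k (· ∘ σ)

/-- `w` is the lexicographically largest word in the support of `y`. -/
def IsLead [LinearOrder S] {b : ℕ} (y : (Fin b → S) →₀ k) (w : Fin b → S) : Prop :=
  y w ≠ 0 ∧ ∀ v, y v ≠ 0 → toLex v ≤ toLex w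

theorem exists_isLead [LinearOrder S] {b : ℕ} {y : (Fin b → S) →₀ k} (hy : y ≠ 0) :
    ∃ w, IsLead y w := by
  obtain ⟨w, hw, hmax⟩ := Finset.exists_max_image y.support toLex
    (Finsupp.support_nonempty_iff.2 hy)
  exact ⟨w, Finsupp.mem_support_iff.1 hw, fun v hv => hmax v (Finsupp.mem_support_iff.2 hv)⟩

theorem IsLead.pullback [LinearOrder S] {c b : ℕ} {σ : Fin c → Fin b}
    (hσ : IsOrderedSurjection σ) {y : (Fin b → S) →₀ k} {w : Fin b → S} (h : IsLead y w) :
    IsLead (pullback k σ y) (w ∘ σ) := by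
  have hinj : Function.Injective (fun v : Fin b → S => v ∘ σ) :=
    hσ.surjective.injective_comp_right
  refine ⟨?_, fun v hv => ?_⟩
  · rw [OutRep.pullback, Finsupp.lmapDomain_apply]
    erw [Finsupp.mapDomain_apply hinj]
    exact h.1
  · classical
    obtain ⟨v', hv', rfl⟩ := Finset.mem_image.1
      (Finsupp.mapDomain_support (Finsupp.mem_support_iff.2 hv))
    rcases (h.2 v' (Finsupp.mem_support_iff.1 hv')).lt_or_eq with hlt | heq
    · exact (hσ.toLex_comp_lt hlt).le
    · rw [toLex_inj.1 heq]

/-- Families of subspaces of `k[S^b]` closed under surjections are finitely generated. -/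
theorem exists_finset_generators [Finite S] (K : ∀ b, Submodule k ((Fin b → S) →₀ k))
    (hK : ∀ {c b} (σ : Fin c → Fin b), Function.Surjective σ → ∀ y ∈ K b, pullback k σ y ∈ K c) :
    ∃ F : Finset (Σ b, (Fin b → S) →₀ k), (∀ y ∈ F, y.2 ∈ K y.1) ∧
      ∀ c, K c ≤ Submodule.span k
        {z | ∃ y ∈ F, ∃ σ : Fin c → Fin y.1, Function.Surjective σ ∧ z = pullback k σ y.2} := by
  classical
  let _ : LinearOrder S := linearOrderOfSTO (WellOrderingRel (α := S))
  -- A Gröbner basis: finitely many leading words lie below all leading words, and `g` picks an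
  -- element of `K` for each.
  obtain ⟨F, hFL, hF⟩ := exists_finset_below (wellQuasiOrdered_wordLE S)
    {w | ∃ y ∈ K w.1, IsLead y w.2}
  choose! g hgK hgL using hFL
  refine ⟨F.image fun w => ⟨w.1, g w⟩, ?_, fun c => ?_⟩
  · intro y hy
    obtain ⟨w, hw, rfl⟩ := Finset.mem_image.1 hy
    exact hgK w hw
  set N := Submodule.span k {z | ∃ y ∈ F.image fun w => (⟨w.1, g w⟩ : Σ b, (Fin b → S) →₀ k),
    ∃ σ : Fin c → Fin y.1, Function.Surjective σ ∧ z = pullback k σ y.2}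
  have key : ∀ w : Lex (Fin c → S), ∀ y ∈ K c, IsLead y (ofLex w) → y ∈ N := by
    intro w
    induction w using WellFoundedLT.induction with
    | ind w ih =>
      intro y hy hlead
      obtain ⟨w₀, hw₀, σ, hσ, hcomp⟩ := hF ⟨c, ofLex w⟩ ⟨y, hy, hlead⟩
      have hlead' : IsLead (pullback k σ (g w₀)) (ofLex w) := by
        have := (hgL w₀ hw₀).pullback hσ
        rwa [← hcomp] at this
      set z := pullback k σ (g w₀)
      have hzN : z ∈ N := Submodule.subset_span
        ⟨_, Finset.mem_image_of_mem _ hw₀, σ, hσ.surjective, rfl⟩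
      have hzK : z ∈ K c := hK σ hσ.surjective _ (hgK w₀ hw₀)
      -- Division step: `z` has the same leading word as `y`, so subtracting `a • z` strictly lowers
      -- it.
      set a := y (ofLex w) / z (ofLex w)
      have hsub : y - a • z ∈ N := by
        by_cases h0 : y - a • z = 0
        · rw [h0]; exact N.zero_mem
        obtain ⟨v, hv⟩ := exists_isLead h0
        refine ih (toLex v) ?_ _ ((K c).sub_mem hy ((K c).smul_mem _ hzK)) hv
        have hvw : v ≠ ofLex w := by
          intro h
          apply hv.1
          rw [h, Finsupp.sub_apply, Finsupp.smul_apply, smul_eq_mul,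
            div_mul_cancel₀ _ hlead'.1, sub_self]
        have hle : toLex v ≤ w := by
          by_cases hyv : y v = 0
          · refine hlead'.2 v fun hzv => hv.1 ?_
            simp [hyv, hzv]
          · exact hlead.2 v hyv
        exact hle.lt_of_ne fun h => hvw (by rw [← h]; rfl)
      have := N.add_mem hsub (N.smul_mem a hzN)
      rwa [sub_add_cancel] at this
  intro y hy
  by_cases h0 : y = 0
  · rw [h0]; exact N.zero_mem
  obtain ⟨w, hw⟩ := exists_isLead h0
  exact key (toLex w) y hy hw

end LeadingTerms

/-! ### Morphisms of full subcategories of `𝒢` -/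

section Morphisms

variable {U : ObjectProperty FinGroup.{u}}

/-- The morphism represented by a surjective homomorphism. -/
def ofHom {A B : U.FullSubcategory} (f : A.obj →* B.obj) (hf : Function.Surjective f) : A ⟶ B :=
  ObjectProperty.homMk (Quotient.mk (FinGroup.conjSetoid A.obj B.obj) ⟨f, hf⟩)

/-- A surjective homomorphism representing a morphism. -/
noncomputable def toHom {A B : U.FullSubcategory} (α : A ⟶ B) : A.obj →* B.obj :=
  (Quotient.out (s := FinGroup.conjSetoid A.obj B.obj) α.hom).1

theorem toHom_surjective {A B : U.FullSubcategory} (α : A ⟶ B) : Function.Surjective (toHom α) :=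
  (Quotient.out (s := FinGroup.conjSetoid A.obj B.obj) α.hom).2

theorem ofHom_toHom {A B : U.FullSubcategory} (α : A ⟶ B) :
    ofHom (toHom α) (toHom_surjective α) = α := by
  apply ObjectProperty.hom_ext
  exact Quotient.out_eq (s := FinGroup.conjSetoid A.obj B.obj) α.hom

theorem ofHom_comp {A B C : U.FullSubcategory} (f : A.obj →* B.obj) (hf : Function.Surjective f)
    (g : B.obj →* C.obj) (hg : Function.Surjective g) :
    ofHom f hf ≫ ofHom g hg = ofHom (U := U) (g.comp f) (hg.comp hf) := rfl

/-- Conjugation in an abelian target is trivial, so a conjugacy class has only one representative.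
-/
theorem toHom_ofHom {A B : U.FullSubcategory} (hB : ∀ a b : B.obj, a * b = b * a)
    (f : A.obj →* B.obj) (hf : Function.Surjective f) : toHom (ofHom f hf) = f := by
  obtain ⟨h, hh⟩ := Quotient.mk_out (s := FinGroup.conjSetoid A.obj B.obj) ⟨f, hf⟩
  ext x
  have := hh x
  rw [hB h, mul_assoc, mul_inv_cancel, mul_one] at this
  exact this.symm

theorem toHom_injective {A B : U.FullSubcategory} :
    Function.Injective (toHom : (A ⟶ B) → (A.obj →* B.obj)) := by
  intro α β h
  rw [← ofHom_toHom α, ← ofHom_toHom β]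
  congr

theorem ofHom_comp_eq {A B C : U.FullSubcategory} (f : A.obj →* B.obj)
    (hf : Function.Surjective f) {β : B ⟶ C} {γ : A ⟶ C}
    (h : ∀ x, toHom β (f x) = toHom γ x) : ofHom f hf ≫ β = γ := by
  rw [← ofHom_toHom β, ← ofHom_toHom γ, ofHom_comp]
  congr 1
  ext x
  exact h x

theorem comp_ofHom_eq {A B C : U.FullSubcategory} {α : A ⟶ B} (g : B.obj →* C.obj)
    (hg : Function.Surjective g) {γ : A ⟶ C}
    (h : ∀ x, g (toHom α x) = toHom γ x) : α ≫ ofHom g hg = γ := by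
  rw [← ofHom_toHom α, ← ofHom_toHom γ, ofHom_comp]
  congr 1
  ext x
  exact h x

theorem ofHom_comp_ofHom_eq {A B C : U.FullSubcategory} (f : A.obj →* B.obj)
    (hf : Function.Surjective f) (g : B.obj →* C.obj) (hg : Function.Surjective g)
    {h : A.obj →* C.obj} (hh : Function.Surjective h) (H : ∀ x, g (f x) = h x) :
    ofHom f hf ≫ ofHom g hg = ofHom (U := U) h hh := by
  obtain rfl : g.comp f = h := MonoidHom.ext H
  rfl

instance {A B : U.FullSubcategory} : Finite (A ⟶ B) :=
  Finite.of_injective (fun α => (toHom α : A.obj → B.obj))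
    (DFunLike.coe_injective.comp toHom_injective)

end Morphisms

/-! ### Cyclic groups -/

/-- For a generator `b`, the order of `g b` is `|G|`, which divides the order `|A|` of `f b`; hence
`f b ↦ g b` is well defined. -/
theorem exists_hom_factor_of_isCyclic {B A G : Type*} [Group B] [Group A] [Group G] [IsCyclic B]
    (f : B →* A) (hf : Function.Surjective f) (g : B →* G) (hg : Function.Surjective g)
    (hcard : Nat.card G ∣ Nat.card A) : ∃ g' : A →* G, g'.comp f = g := by
  obtain ⟨b, hb⟩ := IsCyclic.exists_generator (α := B)
  have hfb : ∀ x, x ∈ Subgroup.zpowers (f b) := fun x => by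
    obtain ⟨y, rfl⟩ := hf x
    obtain ⟨i, rfl⟩ := hb y
    exact ⟨i, by simp⟩
  have hgb : ∀ x, x ∈ Subgroup.zpowers (g b) := fun x => by
    obtain ⟨y, rfl⟩ := hg x
    obtain ⟨i, rfl⟩ := hb y
    exact ⟨i, by simp⟩
  have hord : orderOf (g b) ∣ orderOf (f b) := by
    rwa [orderOf_eq_card_of_forall_mem_zpowers hfb, orderOf_eq_card_of_forall_mem_zpowers hgb]
  refine ⟨monoidHomOfForallMemZpowers hfb hord, ?_⟩
  rw [MonoidHom.eq_iff_eq_on_generator hb]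
  simp

theorem exists_surjective_hom_of_isCyclic {B A : Type*} [Group B] [Group A] [IsCyclic B]
    [IsCyclic A] (hcard : Nat.card A ∣ Nat.card B) :
    ∃ f : B →* A, Function.Surjective f := by
  obtain ⟨b, hb⟩ := IsCyclic.exists_generator (α := B)
  obtain ⟨a, ha⟩ := IsCyclic.exists_generator (α := A)
  have hord : orderOf a ∣ orderOf b := by
    rwa [orderOf_eq_card_of_forall_mem_zpowers hb, orderOf_eq_card_of_forall_mem_zpowers ha]
  refine ⟨monoidHomOfForallMemZpowers hb hord, fun x => ?_⟩
  obtain ⟨i, rfl⟩ := ha x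
  exact ⟨b ^ i, by simp⟩

theorem IsPGroup.card_dvd_card {p : ℕ} [Fact p.Prime] {A B : Type*} [Group A] [Group B] [Finite A]
    [Finite B] (hA : IsPGroup p A) (hB : IsPGroup p B) (h : Nat.card A ≤ Nat.card B) :
    Nat.card A ∣ Nat.card B := by
  obtain ⟨a, ha⟩ := IsPGroup.iff_card.1 hA
  obtain ⟨b, hb⟩ := IsPGroup.iff_card.1 hB
  rw [ha, hb] at h ⊢
  exact pow_dvd_pow p ((Nat.pow_le_pow_iff_right (Fact.out : p.Prime).one_lt).1 h)

/-! ### The groups `(ℤ/q)^c` -/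

/-- The group `(ℤ/q)^c`, in any universe. -/
abbrev FreeMod (q c : ℕ) : Type u := ULift.{u} (Multiplicative (Fin c → ZMod q))

namespace FreeMod

variable {q : ℕ}

/-- The standard basis. -/
def basis (q : ℕ) {c : ℕ} (j : Fin c) : FreeMod.{u} q c :=
  ⟨Multiplicative.ofAdd (Pi.single j 1)⟩

theorem closure_range_basis [NeZero q] (c : ℕ) :
    Subgroup.closure (Set.range (basis.{u} q (c := c))) = ⊤ := by
  rw [eq_top_iff]
  rintro ⟨x⟩ -
  have hx : (⟨x⟩ : FreeMod.{u} q c) = ∏ j, basis q j ^ (Multiplicative.toAdd x j).val := by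
    have hdown : ∀ y, MulEquiv.ulift (⟨y⟩ : FreeMod.{u} q c) = y := fun _ => rfl
    apply MulEquiv.ulift.injective
    rw [map_prod]
    apply Multiplicative.toAdd.injective
    rw [toAdd_prod]
    funext i
    rw [Finset.sum_apply, Finset.sum_eq_single i]
    · simp [basis, hdown]
    · intro j _ hj
      simp [basis, hdown, Pi.single_eq_of_ne hj.symm]
    · simp
  rw [hx]
  exact Subgroup.prod_mem _ fun j _ =>
    Subgroup.pow_mem _ (Subgroup.subset_closure (Set.mem_range_self j)) _

theorem hom_ext [NeZero q] {c : ℕ} {G : Type*} [Group G] {f g : FreeMod.{u} q c →* G}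
    (h : ∀ j, f (basis q j) = g (basis q j)) : f = g :=
  MonoidHom.eq_of_eqOn_dense (closure_range_basis c) (by rintro _ ⟨j, rfl⟩; exact h j)

theorem surjective_of_basis_mem [NeZero q] {c : ℕ} {G : Type*} [Group G]
    (f : G →* FreeMod.{u} q c) (h : ∀ j, basis q j ∈ f.range) : Function.Surjective f := by
  rw [← MonoidHom.range_eq_top, eq_top_iff, ← closure_range_basis, Subgroup.closure_le]
  rintro _ ⟨j, rfl⟩
  exact h j

theorem pow_eq_one {c : ℕ} (x : FreeMod.{u} q c) : x ^ q = 1 := by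
  obtain ⟨x⟩ := x
  apply MulEquiv.ulift.injective
  apply Multiplicative.toAdd.injective
  funext i
  simp

theorem exists_hom_commGroup {c : ℕ} {G : Type*} [CommGroup G] (hq : ∀ g : G, g ^ q = 1)
    (f : Fin c → G) : ∃ φ : FreeMod.{u} q c →* G, ∀ j, φ (basis q j) = f j := by
  -- Exponent dividing `q` makes `G` a `ℤ/q`-module, so the universal property of the basis applies.
  let _ : Module (ZMod q) (Additive G) :=
    AddCommGroup.zmodModule fun x => congrArg Additive.ofMul (hq x.toMul)
  obtain ⟨l, hl⟩ : ∃ l : (Fin c → ZMod q) →+ Additive G,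
      ∀ j, l (Pi.single j 1) = Additive.ofMul (f j) :=
    ⟨((Pi.basisFun (ZMod q) (Fin c)).constr ℕ fun j => Additive.ofMul (f j)).toAddMonoidHom,
      fun j => by
        have := (Pi.basisFun (ZMod q) (Fin c)).constr_basis ℕ (fun j => Additive.ofMul (f j)) j
        rwa [Pi.basisFun_apply] at this⟩
  exact ⟨(AddMonoidHom.toMultiplicativeLeft l).comp MulEquiv.ulift.toMonoidHom,
    fun j => congrArg (fun x : Additive G => x.toMul) (hl j)⟩

theorem exists_hom {c : ℕ} {G : Type*} [inst : Group G] (hcomm : ∀ a b : G, a * b = b * a)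
    (hq : ∀ g : G, g ^ q = 1) (f : Fin c → G) :
    ∃ φ : FreeMod.{u} q c →* G, ∀ j, φ (basis q j) = f j :=
  @exists_hom_commGroup q c G { inst with mul_comm := hcomm } hq f

theorem exists_pushforward [NeZero q] {b c : ℕ} (σ : Fin c → Fin b) (hσ : Function.Surjective σ) :
    ∃ φ : FreeMod.{u} q c →* FreeMod.{u} q b, Function.Surjective φ ∧
      ∀ j, φ (basis q j) = basis q (σ j) := by
  obtain ⟨φ, hφ⟩ := exists_hom.{u} (q := q) (G := FreeMod.{u} q b) mul_comm pow_eq_one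
    fun j => basis q (σ j)
  refine ⟨φ, surjective_of_basis_mem φ fun i => ?_, hφ⟩
  obtain ⟨j, rfl⟩ := hσ i
  exact ⟨_, hφ j⟩

/-- One position per value of `f` is chosen, and these are enlarged to a set `J` of size `a`.
Retracting `Fin b` onto `J`, each other position going to the chosen one with the same value, leaves
`f` unchanged. -/
theorem exists_factor_fin {G : Type*} [Finite G] {a b : ℕ} (f : Fin b → G) (hG : Nat.card G ≤ a)
    (hab : a ≤ b) :
    ∃ (τ : Fin b → Fin a) (f' : Fin a → G), Function.Surjective τ ∧ f = f' ∘ τ := by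
  classical
  have := Fintype.ofFinite G
  choose s hs using fun x : Set.range f => x.2
  have hcard : (Finset.univ.image s).card ≤ a :=
    Finset.card_image_le.trans <| (Finset.card_univ (α := Set.range f)).le.trans <|
      (Fintype.card_subtype_le _).trans (by rwa [← Nat.card_eq_fintype_card])
  obtain ⟨J, hsJ, hJ⟩ := Finset.exists_superset_card_eq hcard (by simpa using hab)
  let e := J.equivFinOfCardEq hJ
  let t : Fin b → J := fun j => if h : j ∈ J then ⟨j, h⟩ else
    ⟨s ⟨f j, j, rfl⟩, hsJ (Finset.mem_image_of_mem _ (Finset.mem_univ _))⟩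
  have ht : ∀ j, f (t j) = f j := fun j => by
    by_cases h : j ∈ J
    · simp [t, h]
    · simp only [t, h, dif_neg, not_false_eq_true]
      exact hs ⟨f j, j, rfl⟩
  refine ⟨e ∘ t, fun i => f (e.symm i), e.surjective.comp fun j => ⟨j, ?_⟩, ?_⟩
  · simp [t]
  · funext j
    simp [ht]

theorem exists_factor [NeZero q] {a b : ℕ} {G : Type*} [Group G] [Finite G]
    (hcomm : ∀ a b : G, a * b = b * a) (g : FreeMod.{u} q b →* G) (hg : Function.Surjective g)
    (hG : Nat.card G ≤ a) (hab : a ≤ b) :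
    ∃ (β : FreeMod.{u} q b →* FreeMod.{u} q a) (g' : FreeMod.{u} q a →* G),
      Function.Surjective β ∧ Function.Surjective g' ∧ g'.comp β = g := by
  obtain ⟨τ, f', hτ, hf⟩ := exists_factor_fin (fun j => g (basis q j)) hG hab
  obtain ⟨β, hβ, hβτ⟩ := exists_pushforward.{u} (q := q) τ hτ
  have hq : ∀ x : G, x ^ q = 1 := fun x => by
    obtain ⟨y, rfl⟩ := hg x
    rw [← map_pow, pow_eq_one, map_one]
  obtain ⟨g', hg'⟩ := exists_hom.{u} hcomm hq f'
  have hcomp : g'.comp β = g := hom_ext fun j => by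
    rw [MonoidHom.comp_apply, hβτ, hg']
    exact (congrFun hf j).symm
  refine ⟨β, g', hβ, ?_, hcomp⟩
  rw [← hcomp] at hg
  exact Function.Surjective.of_comp hg

/-- Surjections onto `A` from `(ℤ/q)^c` with `c` large factor through a given surjection `α`. -/
theorem exists_lift [NeZero q] {A B : Type*} [Group A] [Group B] [Finite A] [Finite B]
    (hcomm : ∀ a b : B, a * b = b * a) (hq : ∀ x : B, x ^ q = 1)
    (α : B →* A) (hα : Function.Surjective α) {c : ℕ} (hc : Nat.card A * Nat.card B < c)
    (γ : FreeMod.{u} q c →* A) (hγ : Function.Surjective γ) :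
    ∃ β : FreeMod.{u} q c →* B, Function.Surjective β ∧ α.comp β = γ := by
  classical
  have := Fintype.ofFinite A
  have := Fintype.ofFinite B
  -- By pigeonhole more than `|B|` basis vectors share one value `a`: enough for their lifts to
  -- exhaust the fibre of `α` over `a`.
  obtain ⟨a, ha⟩ := Fintype.exists_lt_card_fiber_of_mul_lt_card (n := Nat.card B)
    (fun j : Fin c => γ (basis q j)) (by simpa [Nat.card_eq_fintype_card] using hc)
  let J := {j : Fin c // γ (basis q j) = a}
  let Y := {y : B // α y = a}
  have hne : Nonempty Y := (hα a).elim fun y hy => ⟨⟨y, hy⟩⟩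
  obtain ⟨t, ht⟩ : ∃ t : J → Y, Function.Surjective t := by
    have hle : Fintype.card Y ≤ Fintype.card J := by
      refine (Fintype.card_subtype_le _).trans ?_
      rw [Fintype.card_subtype, ← Nat.card_eq_fintype_card]
      exact ha.le
    obtain ⟨e⟩ := Function.Embedding.nonempty_of_card_le hle
    exact ⟨Function.invFun e, Function.invFun_surjective e.injective⟩
  have key : ∃ f : Fin c → B, (∀ j, α (f j) = γ (basis q j)) ∧ ∀ y, α y = a → ∃ j, f j = y := by
    refine ⟨fun j => if h : γ (basis q j) = a then (t ⟨j, h⟩).1 else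
      Function.surjInv hα (γ (basis q j)), fun j => ?_, fun y hy => ?_⟩
    · by_cases h : γ (basis q j) = a
      · simp only [h, dif_pos]
        exact (t ⟨j, h⟩).2
      · simp only [h, dif_neg, not_false_eq_true]
        exact Function.surjInv_eq hα _
    · obtain ⟨⟨j, hj⟩, h⟩ := ht ⟨y, hy⟩
      exact ⟨j, by simp [hj, h]⟩
  obtain ⟨f, hf, hfa⟩ := key
  obtain ⟨β, hβ⟩ := exists_hom.{u} hcomm hq f
  have hcomp : α.comp β = γ := hom_ext fun j => by rw [MonoidHom.comp_apply, hβ, hf]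
  have hmem : ∀ y, α y = a → y ∈ β.range := fun y hy => by
    obtain ⟨j, rfl⟩ := hfa y hy
    exact ⟨_, hβ j⟩
  refine ⟨β, fun y => ?_, hcomp⟩
  obtain ⟨x, hx⟩ := hγ (α y)
  obtain ⟨z, hz⟩ := hα a
  have hx' : α (β x) = α y := by rw [← hx, ← hcomp]; rfl
  -- The range of `β` contains a whole coset of `ker α`, hence `ker α` itself, and it maps onto `A`.
  have h1 : z * ((β x)⁻¹ * y) ∈ β.range := hmem _ (by simp [hx', hz])
  have h2 : (β x)⁻¹ * y ∈ β.range := (β.range.mul_mem_cancel_left (hmem z hz)).1 h1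
  exact (β.range.mul_mem_cancel_left (β.range.inv_mem ⟨x, rfl⟩)).1 h2

end FreeMod

/-! ### Generators -/

section Generators

variable {k : Type u} [Field k] {U : ObjectProperty FinGroup.{u}}

theorem structureMap_comp (X : RepCat k U) {A B C : U.FullSubcategory} (β : C ⟶ B) (α : B ⟶ A)
    (x : X.obj (Opposite.op A)) :
    structureMap X (β ≫ α) x = structureMap X β (structureMap X α x) := by
  simp [structureMap]

theorem structureMap_id (X : RepCat k U) {A : U.FullSubcategory} (x : X.obj (Opposite.op A)) :
    structureMap X (𝟙 A) x = x := by
  simp [structureMap]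

/-- The quotient of `X` by a family of subspaces stable under the structure maps. -/
noncomputable def quotient (X : RepCat k U) (Y : ∀ A, Submodule k (X.obj (Opposite.op A)))
    (hY : ∀ {A B : U.FullSubcategory} (α : B ⟶ A), Y A ≤ (Y B).comap (structureMap X α)) :
    RepCat k U where
  obj A := ModuleCat.of k (X.obj A ⧸ Y A.unop)
  map f := ModuleCat.ofHom (Submodule.mapQ (Y _) (Y _) (X.map f).hom (hY f.unop))
  map_id A := by
    ext x
    simp
  map_comp f g := by
    ext x
    exact congrArg Submodule.Quotient.mk (congrArg (fun φ => φ.hom x) (X.map_comp f g))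

/-- The projection onto `quotient X Y hY`. -/
noncomputable def quotientProj (X : RepCat k U) (Y : ∀ A, Submodule k (X.obj (Opposite.op A)))
    (hY : ∀ {A B : U.FullSubcategory} (α : B ⟶ A), Y A ≤ (Y B).comap (structureMap X α)) :
    X ⟶ quotient X Y hY where
  app A := ModuleCat.ofHom (Submodule.mkQ (Y A.unop))
  naturality _ _ _ := rfl

/-- The elements `y i ∈ X(G i)` generate `X`. -/
def Generates (X : RepCat k U) {m : ℕ} (G : Fin m → U.FullSubcategory)
    (y : ∀ i, X.obj (Opposite.op (G i))) : Prop :=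
  ∀ H, Submodule.span k {x | ∃ i, ∃ g : H ⟶ G i, x = structureMap X g (y i)} = ⊤

/-- By Yoneda, `y i` is the image of the identity of `G i`. The projection of `X` modulo the
subobject spanned by the `y i` vanishes after composition with the epimorphism `f`, so it is zero.
-/
theorem IsFinitelyGenerated.exists_generates {X : RepCat k U} (hX : IsFinitelyGenerated X) :
    ∃ (m : ℕ) (G : Fin m → U.FullSubcategory) (y : ∀ i, X.obj (Opposite.op (G i))),
      Generates X G y := by
  obtain ⟨m, G, f, hf⟩ := hX
  let t : ∀ i, generator k (G i) ⟶ X := fun i =>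
    Limits.Sigma.ι (fun i => generator k (G i)) i ≫ f
  let y : ∀ i, X.obj (Opposite.op (G i)) := fun i =>
    ((t i).app (Opposite.op (G i))).hom (Finsupp.single (𝟙 (G i)) (1 : k))
  have hy : ∀ i {H : U.FullSubcategory} (g : H ⟶ G i),
      ((t i).app (Opposite.op H)).hom (Finsupp.single g (1 : k)) = structureMap X g (y i) := by
    intro i H g
    have h := congrArg (fun φ => φ.hom (Finsupp.single (𝟙 (G i)) (1 : k)))
      ((t i).naturality g.op)
    refine Eq.trans ?_ h
    change _ = ((t i).app (Opposite.op H)).hom (Finsupp.mapDomain _ _)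
    rw [Finsupp.mapDomain_single]
    congr 2
    exact (Category.comp_id g).symm
  let Y : ∀ A, Submodule k (X.obj (Opposite.op A)) := fun H =>
    Submodule.span k {x | ∃ i, ∃ g : H ⟶ G i, x = structureMap X g (y i)}
  have hY : ∀ {A B : U.FullSubcategory} (α : B ⟶ A), Y A ≤ (Y B).comap (structureMap X α) := by
    intro A B α
    refine Submodule.span_le.2 ?_
    rintro _ ⟨i, g, rfl⟩
    exact Submodule.subset_span ⟨i, α ≫ g, (structureMap_comp X α g _).symm⟩
  refine ⟨m, G, y, fun H => ?_⟩
  have hzero : f ≫ quotientProj X Y hY = f ≫ 0 := by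
    rw [Limits.comp_zero]
    refine Limits.Sigma.hom_ext _ _ fun i => ?_
    rw [← Category.assoc, Limits.comp_zero]
    refine NatTrans.ext (funext fun H => ?_)
    refine ModuleCat.hom_ext (Finsupp.lhom_ext' fun g => LinearMap.ext_ring ?_)
    change Submodule.Quotient.mk (((t i).app H).hom (Finsupp.single g (1 : k))) = _
    refine (Submodule.Quotient.mk_eq_zero _).2 ?_
    rw [hy i (H := H.unop) g]
    exact Submodule.subset_span ⟨i, g, rfl⟩
  have hproj := (cancel_epi f).1 hzero
  rw [eq_top_iff]
  intro x _
  have hx := congrArg (fun φ => (φ.app (Opposite.op H)).hom x) hproj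
  exact (Submodule.Quotient.mk_eq_zero (Y H)).1 hx

theorem surjective_actionMap_of_surjective (X : RepCat k U) {A B : U.FullSubcategory} (α : B ⟶ A)
    (h : Function.Surjective (structureMap X α)) : Function.Surjective (actionMap X A B) := by
  intro x
  obtain ⟨z, rfl⟩ := h x
  exact ⟨_, actionMap_tmul_single X A B z α⟩

theorem Generates.finiteDimensional {X : RepCat k U} {m : ℕ} {G : Fin m → U.FullSubcategory}
    {y : ∀ i, X.obj (Opposite.op (G i))} (hy : Generates X G y) (H : U.FullSubcategory) :
    FiniteDimensional k (X.obj (Opposite.op H)) := by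
  refine Module.finite_def.2 (hy H ▸ Submodule.fg_span ?_)
  refine (Set.finite_range fun w : Σ i, (H ⟶ G i) => structureMap X w.2 (y w.1)).subset ?_
  rintro _ ⟨i, g, rfl⟩
  exact ⟨⟨i, g⟩, rfl⟩

end Generators

/-! ### Cyclic groups -/

section Cyclic

variable {k : Type u} [Field k] {p : ℕ} [Fact p.Prime] {X : RepCat k (abelianPGroups.{u} p)}
  {m : ℕ} {G : Fin m → (abelianPGroups.{u} p).FullSubcategory}
  {y : ∀ i, X.obj (Opposite.op (G i))}

theorem Generates.surjective_of_isCyclic (hy : Generates X G y) :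
    ∃ r : ℕ, ∀ (A B : (abelianPGroups.{u} p).FullSubcategory) (α : B ⟶ A), IsCyclic B.obj →
      r ≤ Nat.card A.obj → Function.Surjective (structureMap X α) := by
  refine ⟨Finset.univ.sup fun i => Nat.card (G i).obj, fun A B α hB hA => ?_⟩
  rw [← LinearMap.range_eq_top, eq_top_iff, ← hy B, Submodule.span_le]
  rintro _ ⟨i, g, rfl⟩
  have hle : Nat.card (G i).obj ≤ Nat.card A.obj :=
    (Finset.le_sup (f := fun i => Nat.card (G i).obj) (Finset.mem_univ i)).trans hA
  obtain ⟨g', hg'⟩ := exists_hom_factor_of_isCyclic (toHom α) (toHom_surjective α) (toHom g)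
    (toHom_surjective g) (IsPGroup.card_dvd_card (G i).property.2 A.property.2 hle)
  have hsurj : Function.Surjective g' := by
    refine Function.Surjective.of_comp (g := toHom α) ?_
    rw [← MonoidHom.coe_comp, hg']
    exact toHom_surjective g
  refine ⟨structureMap X (ofHom g' hsurj) (y i), ?_⟩
  rw [← structureMap_comp]
  congr 2
  exact comp_ofHom_eq g' hsurj fun x => DFunLike.congr_fun hg' x

theorem Generates.cyclic (hy : Generates X G y) :
    EventuallyTorsionFree (restrict (cyclicPGroups_le p) X) ∧
      StablySurjective (restrict (cyclicPGroups_le p) X) := by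
  obtain ⟨r, hr⟩ := hy.surjective_of_isCyclic
  have hr' : ∀ (A B : (cyclicPGroups.{u} p).FullSubcategory) (α : B ⟶ A), r ≤ Nat.card A.obj →
      Function.Surjective (structureMap (restrict (cyclicPGroups_le p) X) α) :=
    fun A B α hA => hr _ _ ((ObjectProperty.ιOfLE (cyclicPGroups_le p)).map α) B.property.1 hA
  have hex : ∀ A B : (cyclicPGroups.{u} p).FullSubcategory, Nat.card A.obj ≤ Nat.card B.obj →
      Nonempty (B ⟶ A) := fun A B h => by
    have := A.property.1
    have := B.property.1
    obtain ⟨f, hf⟩ := exists_surjective_hom_of_isCyclic (B := B.obj) (A := A.obj)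
      (IsPGroup.card_dvd_card A.property.2 B.property.2 h)
    exact ⟨ofHom f hf⟩
  have hfin : ∀ A : (cyclicPGroups.{u} p).FullSubcategory,
      FiniteDimensional k ((restrict (cyclicPGroups_le p) X).obj (Opposite.op A)) :=
    fun A => hy.finiteDimensional ((ObjectProperty.ιOfLE (cyclicPGroups_le p)).obj A)
  refine ⟨?_, r, fun A B hA hAB => ?_⟩
  · let d : (cyclicPGroups.{u} p).FullSubcategory → ℕ := fun A =>
      Module.finrank k ((restrict (cyclicPGroups_le p) X).obj (Opposite.op A))
    by_cases hne : {A : (cyclicPGroups.{u} p).FullSubcategory | r ≤ Nat.card A.obj}.Nonempty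
    -- `A₀` minimises the dimension in the stable range. Each larger `A` surjects onto `A₀`, so its
    -- dimension is at most, hence equal to, this minimum.
    · obtain ⟨A₀, hA₀, hmin⟩ := WellFounded.has_min (InvImage.wf d wellFounded_lt) _ hne
      have hd : ∀ A : (cyclicPGroups.{u} p).FullSubcategory, Nat.card A₀.obj ≤ Nat.card A.obj →
          d A = d A₀ := fun A hA => by
        obtain ⟨α⟩ := hex A₀ A hA
        exact le_antisymm (LinearMap.finrank_le_finrank_of_surjective (hr' A₀ A α hA₀))
          (not_lt.1 (hmin A (le_trans hA₀ hA : r ≤ _)))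
      refine ⟨Nat.card A₀.obj, fun A B α hA => ?_⟩
      have hAB : Nat.card A.obj ≤ Nat.card B.obj :=
        Nat.card_le_card_of_surjective _ (toHom_surjective α)
      have := hfin A
      have := hfin B
      exact (LinearMap.injective_iff_surjective_of_finrank_eq_finrank
        ((hd A hA).trans (hd B (hA.trans hAB)).symm)).2 (hr' A B α (le_trans hA₀ hA))
    · exact ⟨r, fun A B α hA => absurd ⟨A, hA⟩ hne⟩
  · obtain ⟨α⟩ := hex A B hAB
    exact surjective_actionMap_of_surjective _ α (hr' A B α hA)

end Cyclic

/-! ### Free `ℤ/p^n`-modules -/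

section Free

variable {p n : ℕ}

theorem exists_iso_freeObj {A : FinGroup.{u}} (hA : freeModGroups p n A) :
    ∃ a, Nat.card A = p ^ (n * a) ∧ Nonempty (FreeMod.{u} (p ^ n) a ≃* A) := by
  obtain ⟨a, ⟨e⟩⟩ := hA
  refine ⟨a, ?_, ⟨MulEquiv.ulift.trans e.symm⟩⟩
  rw [Nat.card_congr e.toEquiv, Nat.card_congr Multiplicative.toAdd, Nat.card_fun,
    Nat.card_zmod, Nat.card_fin, pow_mul]

theorem toHom_comp_apply {A B C : (abelianPGroups.{u} p).FullSubcategory} (α : A ⟶ B) (β : B ⟶ C)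
    (x : A.obj) : toHom (α ≫ β) x = toHom β (toHom α x) := by
  conv_lhs => rw [← ofHom_toHom α, ← ofHom_toHom β, ofHom_comp, toHom_ofHom C.property.1]
  rfl

variable (p n) [Fact p.Prime]

/-- The object `(ℤ/p^n)^c` of `𝒵[p^∞]`. -/
def freeObj (c : ℕ) : (abelianPGroups.{u} p).FullSubcategory :=
  ⟨⟨FreeMod.{u} (p ^ n) c⟩, freeModGroups_le p n _ ⟨c, ⟨MulEquiv.ulift⟩⟩⟩

variable {p n}

theorem exists_freeObj_hom {b c : ℕ} (σ : Fin c → Fin b) (hσ : Function.Surjective σ) :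
    ∃ φ : freeObj.{u} p n c ⟶ freeObj p n b,
      ∀ j, toHom φ (FreeMod.basis (p ^ n) j) = FreeMod.basis (p ^ n) (σ j) := by
  obtain ⟨f, hf, h⟩ := FreeMod.exists_pushforward.{u} (q := p ^ n) σ hσ
  have hf' := toHom_ofHom (A := freeObj.{u} p n c) (B := freeObj.{u} p n b)
    (freeObj p n b).property.1 f hf
  exact ⟨ofHom (A := freeObj.{u} p n c) (B := freeObj.{u} p n b) f hf, fun j =>
    (congrArg (fun φ => φ (FreeMod.basis (p ^ n) j)) hf').trans (h j)⟩

variable {k : Type u} [Field k] (X : RepCat k (abelianPGroups.{u} p))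

/-- Elements of `X((ℤ/p^n)^b)` killed by all maps from `(ℤ/p^n)^c` with `c` large. -/
def torsion (n b : ℕ) : Submodule k (X.obj (Opposite.op (freeObj p n b))) where
  carrier := {x | ∃ N, ∀ c ≥ N, ∀ γ : freeObj p n c ⟶ freeObj p n b, structureMap X γ x = 0}
  zero_mem' := ⟨0, fun _ _ _ => map_zero _⟩
  add_mem' := by
    rintro x y ⟨N, hN⟩ ⟨M, hM⟩
    refine ⟨max N M, fun c hc γ => ?_⟩
    rw [map_add, hN c ((le_max_left _ _).trans hc), hM c ((le_max_right _ _).trans hc), add_zero]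
  smul_mem' := by
    rintro a x ⟨N, hN⟩
    exact ⟨N, fun c hc γ => by rw [map_smul, hN c hc, smul_zero]⟩

variable {X}

theorem structureMap_mem_torsion {b c : ℕ} (φ : freeObj p n c ⟶ freeObj p n b)
    {x : X.obj (Opposite.op (freeObj p n b))} (hx : x ∈ torsion X n b) :
    structureMap X φ x ∈ torsion X n c := by
  obtain ⟨N, hN⟩ := hx
  exact ⟨N, fun d hd γ => by rw [← structureMap_comp, hN d hd]⟩

variable {m : ℕ} {G : Fin m → (abelianPGroups.{u} p).FullSubcategory}
  {y : ∀ i, X.obj (Opposite.op (G i))}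

/-- The word of values of a morphism on the standard basis. -/
noncomputable def word {b : ℕ} (w : Σ i, (freeObj p n b ⟶ G i)) : Fin b → Σ i, (G i).obj :=
  fun j => ⟨w.1, toHom w.2 (FreeMod.basis (p ^ n) j)⟩

/-- Rank `0` is excluded because the empty word forgets the index `i`. -/
theorem word_injective {b : ℕ} (hb : 1 ≤ b) :
    Function.Injective (word (p := p) (n := n) (G := G) (b := b)) := by
  rintro ⟨i, g⟩ ⟨i', g'⟩ h
  obtain rfl : i = i' := congrArg Sigma.fst (congrFun h ⟨0, hb⟩)
  congr 1
  refine toHom_injective (FreeMod.hom_ext fun j => ?_)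
  exact eq_of_heq (Sigma.mk.inj (congrFun h j)).2

variable (X y) in
/-- The map from the free module on morphisms to the `G i`. -/
noncomputable def presentation (n b : ℕ) :
    ((Σ i, (freeObj p n b ⟶ G i)) →₀ k) →ₗ[k] X.obj (Opposite.op (freeObj p n b)) :=
  Finsupp.linearCombination k fun w => structureMap X w.2 (y w.1)

theorem Generates.presentation_surjective (hy : Generates X G y) (b : ℕ) :
    Function.Surjective (presentation X y n b) := by
  rw [← LinearMap.range_eq_top, eq_top_iff, ← hy, Submodule.span_le]
  rintro _ ⟨i, g, rfl⟩
  exact ⟨Finsupp.single ⟨i, g⟩ 1, by simp [presentation]⟩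

theorem presentation_precomp {b c : ℕ} (φ : freeObj p n c ⟶ freeObj p n b)
    (z : (Σ i, (freeObj p n b ⟶ G i)) →₀ k) :
    presentation X y n c (Finsupp.lmapDomain k k (fun w => ⟨w.1, φ ≫ w.2⟩) z) =
      structureMap X φ (presentation X y n b z) := by
  induction z using Finsupp.induction_linear with
  | zero => simp
  | add u v hu hv => simp only [map_add, hu, hv]
  | single w a => simp [presentation, structureMap_comp, Finsupp.mapDomain_single]

/-- Translates the action of basis-permuting-and-merging maps into precomposition of words, the
setting of `exists_finset_generators`. -/
theorem pullback_word {b c : ℕ} {σ : Fin c → Fin b} {φ : freeObj.{u} p n c ⟶ freeObj p n b}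
    (hφ : ∀ j, toHom φ (FreeMod.basis (p ^ n) j) = FreeMod.basis (p ^ n) (σ j))
    (z : (Σ i, (freeObj p n b ⟶ G i)) →₀ k) :
    pullback k σ (Finsupp.lmapDomain k k word z) =
      Finsupp.lmapDomain k k word (Finsupp.lmapDomain k k (fun w => ⟨w.1, φ ≫ w.2⟩) z) := by
  simp only [pullback, Finsupp.lmapDomain_apply, ← Finsupp.mapDomain_comp]
  congr 1
  funext w j
  refine Sigma.ext rfl (heq_of_eq ?_)
  exact ((toHom_comp_apply φ w.2 _).trans (congrArg (toHom w.2) (hφ j))).symm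

/-- The torsion of a finitely generated object vanishes in large rank. -/
theorem Generates.torsion_eventually_eq_bot (hy : Generates X G y) (n : ℕ) :
    ∃ r, ∀ c ≥ r, torsion X n c = ⊥ := by
  -- The torsion is pulled back to the free module on morphisms and then written in words.
  let K : ∀ b, Submodule k ((Fin b → Σ i, (G i).obj) →₀ k) := fun b =>
    ((torsion X n b).comap (presentation X y n b)).map (Finsupp.lmapDomain k k word)
  obtain ⟨F, hFK, hF⟩ := exists_finset_generators K (by
    rintro c b σ hσ _ ⟨z, hz, rfl⟩
    obtain ⟨φ, hφ⟩ := exists_freeObj_hom.{u} (p := p) (n := n) σ hσ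
    rw [pullback_word hφ]
    refine ⟨_, ?_, rfl⟩
    have := structureMap_mem_torsion φ hz
    rwa [← presentation_precomp] at this)
  have hN : ∀ v ∈ F, ∃ N, ∃ z, Finsupp.lmapDomain k k word z = v.2 ∧
      ∀ c ≥ N, ∀ γ : freeObj p n c ⟶ freeObj p n v.1,
        structureMap X γ (presentation X y n v.1 z) = 0 := by
    intro v hv
    obtain ⟨z, ⟨N, hN⟩, hz⟩ := hFK v hv
    exact ⟨N, z, hz, hN⟩
  choose! N hN using hN
  -- Beyond `F.sup N` every generator is killed; the `1` makes `word` injective, so that relations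
  -- between words descend to morphisms.
  refine ⟨max 1 (F.sup N), fun c hc => ?_⟩
  have hle : K c ≤ (LinearMap.ker (presentation X y n c)).map (Finsupp.lmapDomain k k word) := by
    refine (hF c).trans (Submodule.span_le.2 ?_)
    rintro _ ⟨v, hv, σ, hσ, rfl⟩
    obtain ⟨z, hz, hzero⟩ := hN v hv
    obtain ⟨φ, hφ⟩ := exists_freeObj_hom.{u} (p := p) (n := n) σ hσ
    rw [← hz, pullback_word hφ]
    refine ⟨_, ?_, rfl⟩
    have hcN : N v ≤ c := (Finset.le_sup hv).trans ((le_max_right _ _).trans hc)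
    exact (presentation_precomp φ z).trans (hzero c hcN φ)
  rw [eq_bot_iff]
  intro x hx
  obtain ⟨z, rfl⟩ := hy.presentation_surjective c x
  obtain ⟨z', hz', heq⟩ := hle ⟨z, hx, rfl⟩
  rw [← Finsupp.mapDomain_injective (word_injective ((le_max_left _ _).trans hc)) heq]
  exact hz'

theorem Generates.free_torsionFree (hy : Generates X G y) (hn : 1 ≤ n) :
    EventuallyTorsionFree (restrict (freeModGroups_le p n) X) := by
  obtain ⟨r, hr⟩ := hy.torsion_eventually_eq_bot n
  refine ⟨p ^ (n * r), fun A B α hA => ?_⟩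
  obtain ⟨a, ha, ⟨e⟩⟩ := exists_iso_freeObj A.property
  obtain ⟨b, -, ⟨e'⟩⟩ := exists_iso_freeObj B.property
  have har : r ≤ a := by
    rw [ha, Nat.pow_le_pow_iff_right (Fact.out : p.Prime).one_lt] at hA
    exact Nat.le_of_mul_le_mul_left hA hn
  let A' := (ObjectProperty.ιOfLE (freeModGroups_le p n)).obj A
  let B' := (ObjectProperty.ιOfLE (freeModGroups_le p n)).obj B
  let α' : B' ⟶ A' := (ObjectProperty.ιOfLE (freeModGroups_le p n)).map α
  let ε : freeObj p n a ⟶ A' := ofHom e.toMonoidHom e.surjective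
  let ε' : A' ⟶ freeObj p n a := ofHom e.symm.toMonoidHom e.symm.surjective
  have hε : ε' ≫ ε = 𝟙 A' :=
    ofHom_comp_ofHom_eq _ _ _ _ (h := MonoidHom.id _) Function.surjective_id e.apply_symm_apply
  change Function.Injective (structureMap X α')
  rw [injective_iff_map_eq_zero]
  intro x hx
  have hmem : structureMap X ε x ∈ torsion X n a := by
    -- Above this rank `γ ≫ ε` factors through `α'`, which kills `x`.
    refine ⟨Nat.card A'.obj * Nat.card B'.obj + 1, fun c hc γ => ?_⟩
    obtain ⟨β, hβ, hcomp⟩ := FreeMod.exists_lift.{u} (q := p ^ n) B'.property.1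
      (fun x : B'.obj => e'.symm.injective (by
        rw [map_pow, FreeMod.pow_eq_one, map_one])) (toHom α') (toHom_surjective α')
      (Nat.lt_of_succ_le hc) (toHom (γ ≫ ε)) (toHom_surjective _)
    have hfac : (ofHom β hβ : freeObj p n c ⟶ B') ≫ α' = γ ≫ ε :=
      ofHom_comp_eq (A := freeObj p n c) β hβ fun x => congrArg (fun φ => φ x) hcomp
    rw [← structureMap_comp, ← hfac, structureMap_comp, hx, map_zero]
  rw [hr a har, Submodule.mem_bot] at hmem
  rw [← structureMap_id X x, ← hε, structureMap_comp, hmem, map_zero]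

/-- Each `g : B → G i` factors through `A` once the rank of `A` is at least every `|G i|`. The map
`B → A` depends on `g`, so no single `α^*` is claimed to be surjective, in contrast to the cyclic
case. -/
theorem Generates.free_stablySurjective (hy : Generates X G y) (hn : 1 ≤ n) :
    StablySurjective (restrict (freeModGroups_le p n) X) := by
  have hp := (Fact.out : p.Prime).one_lt
  refine ⟨p ^ (n * Finset.univ.sup fun i => Nat.card (G i).obj), fun A B hA hAB => ?_⟩
  obtain ⟨a, ha, ⟨e⟩⟩ := exists_iso_freeObj A.property
  obtain ⟨b, hb, ⟨e'⟩⟩ := exists_iso_freeObj B.property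
  rw [ha, Nat.pow_le_pow_iff_right hp] at hA
  rw [ha, hb, Nat.pow_le_pow_iff_right hp] at hAB
  replace hA := Nat.le_of_mul_le_mul_left hA hn
  replace hAB := Nat.le_of_mul_le_mul_left hAB hn
  let A' := (ObjectProperty.ιOfLE (freeModGroups_le p n)).obj A
  let B' := (ObjectProperty.ιOfLE (freeModGroups_le p n)).obj B
  rw [← LinearMap.range_eq_top, eq_top_iff]
  refine (hy B').symm.le.trans (Submodule.span_le.2 ?_)
  rintro _ ⟨i, g, rfl⟩
  have hi : Nat.card (G i).obj ≤ a :=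
    (Finset.le_sup (f := fun i => Nat.card (G i).obj) (Finset.mem_univ i)).trans hA
  obtain ⟨β, g', hβ, hg', hcomp⟩ := FreeMod.exists_factor.{u} (q := p ^ n) (G i).property.1
    ((toHom g).comp e'.toMonoidHom) ((toHom_surjective g).comp e'.surjective) hi hAB
  let β' : B.obj →* A.obj := e.toMonoidHom.comp (β.comp e'.symm.toMonoidHom)
  have hβ' : Function.Surjective β' := e.surjective.comp (hβ.comp e'.symm.surjective)
  let γ : A' ⟶ G i := ofHom (g'.comp e.symm.toMonoidHom) (hg'.comp e.symm.surjective)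
  have hfac : (ofHom β' hβ' : B' ⟶ A') ≫ γ = g := by
    rw [← ofHom_toHom g]
    refine ofHom_comp_ofHom_eq _ _ _ _ _ fun x => ?_
    have := DFunLike.congr_fun hcomp (e'.symm x)
    simpa [β'] using this
  refine ⟨TensorProduct.tmul k (structureMap X γ (y i)) (Finsupp.single (ofHom β' hβ') 1), ?_⟩
  refine (actionMap_tmul_single (restrict (freeModGroups_le p n) X) A B _ _).trans ?_
  rw [← hfac, structureMap_comp]
  rfl

end Free

end OutRep

theorem mainTheorem5 (k : Type u) [Field k] [CharZero k] (p : ℕ) (hp : p.Prime)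
    (X : OutRep.RepCat k (OutRep.abelianPGroups.{u} p)) (hX : OutRep.IsFinitelyGenerated X) :
    (OutRep.EventuallyTorsionFree (OutRep.restrict (OutRep.cyclicPGroups_le p) X) ∧
      OutRep.StablySurjective (OutRep.restrict (OutRep.cyclicPGroups_le p) X)) ∧
    ∀ n : ℕ, 1 ≤ n →
      OutRep.EventuallyTorsionFree (OutRep.restrict (OutRep.freeModGroups_le p n) X) ∧
      OutRep.StablySurjective (OutRep.restrict (OutRep.freeModGroups_le p n) X) := by
  have : Fact p.Prime := ⟨hp⟩
  obtain ⟨m, G, y, hy⟩ := hX.exists_generates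
  exact ⟨hy.cyclic, fun n hn => ⟨hy.free_torsionFree hn, hy.free_stablySurjective hn⟩⟩
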